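/- Let $(\mathbb{K},|\cdot|)$ be an algebraically closed normed field (the norm being multiplicative), let $f\in\mathbb{K}[z]$ be a polynomial of degree $n\ge 2$ with leading coefficient $a_0$, let $N\ge 1$, $1\le p\le\infty$, and let $q\in[1,\infty]$ satisfy $1/p+1/q=1$. A vector $\xi\in\mathbb{K}^n$ is a root-vector of $f$ if $f(z)=a_0\prod_{i=1}^n(z-\xi_i)$ for all $z\in\mathbb{K}$. For $x\in\mathbb{K}^n$ write $\|x\|=(|x_1|,\dots,|x_n|)\in\mathbb{R}^n$ and let $\preceq$ be the coordinate-wise order on $\mathbb{R}^n$. For $x$ with distinct components put \[ d_i(x)=\min_{j\ne i}|x_i-x_j|,\qquad W_f(x)=(W_1(x),\dots,W_n(x)),\quad W_i(x)=\frac{f(x_i)}{a_0\prod_{j\ne i}(x_i-x_j)},\qquad E_f(x)=\left\|\left(\frac{|W_1(x)|}{d_1(x)},\dots,\frac{|W_n(x)|}{d_n(x)}\right)\right\|_p . \] Define $T^{(0)}(x)=x$ on $D_0=\mathbb{K}^n$ and, recursively, \[ D_{N+1}=\{x\in D_N:\ x_i\ne T^{(N)}_j(x)\ \text{for all } i\ne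 j\},\qquad T^{(N+1)}_i(x)=x_i-\frac{f(x_i)}{a_0\prod_{j\ne i}\bigl(x_i-T^{(N)}_j(x)\bigr)}\quad(x\in D_{N+1},\ i=1,\dots,n). \] Let $a=(n-1)^{1/q}$, \[ \mathcal{R}=\frac{n(\sqrt[n]{2}-1)\,\bigl(a+2-n(\sqrt[n]{2}-1)\bigr)}{(a+2)\,\bigl(a+2+n(a-1)(\sqrt[n]{2}-1)\bigr)},\qquad \alpha(t)=\frac{2}{1-(a-1)t+\sqrt{(1-(a-1)t)^2-4t}} . \] **Theorem.** Suppose $x^{(0)}\in\mathbb{K}^n$ has distinct components and $E_f(x^{(0)})<\mathcal{R}$. Then $f$ has only simple zeros in $\mathbb{K}$; the iteration $x^{(k+1)}=T^{(N)}(x^{(k)})$, $k=0,1,2,\dots$, is well-defined, that is, $x^{(k)}\in D_N$ for all $k$, and every $x^{(k)}$ has distinct components; and there is a root-vector $\xi$ of $f$ such that $x^{(k)}\to\xi$ with order of convergence (at least) $N+1$, that is, there is a constant $C$ with $\|x^{(k+1)}-\xi\|_p\le C\,\|x^{(k)}-\xi\|_p^{N+1}$ for all $k\ge 0$, and \[ \|x^{(k)}-\xi\|\preceq\alpha\bigl(E_f(x^{(k)})\bigr)\,\|W_f(x^{(k)})\|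 \quad\text{for all } k\ge 0 \text{ such that } E_f(x^{(k)})\le\mathcal{R}. \] -/

import Mathlib

open Filter Topology
open scoped ENNReal

namespace SimRoots

variable {K : Type*} [NormedField K] {n : ℕ}

/-- `ξ` is a root-vector of `f`: `f(z) = a₀ ∏ᵢ (z - ξᵢ)` for all `z`, for some `a₀`. -/
def IsRootVector (f : Polynomial K) (ξ : Fin n → K) : Prop :=
  ∃ a₀ : K, ∀ z : K, f.eval z = a₀ * ∏ i, (z - ξ i)

/-- All zeros of `f` are simple. -/
def OnlySimpleZeros (f : Polynomial K) : Prop :=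
  ∀ z : K, f.IsRoot z → f.rootMultiplicity z = 1

/-- The relation `x # y`: `xᵢ ≠ yⱼ` whenever `i ≠ j`. -/
def Sharp (x y : Fin n → K) : Prop :=
  ∀ i j : Fin n, i ≠ j → x i ≠ y j

/-- The cone norm `‖x‖ = (|x₁|, …, |xₙ|)`, with values in `ℝⁿ` ordered coordinate-wise. -/
def coneNorm (x : Fin n → K) : Fin n → ℝ :=
  fun i => ‖x i‖

/-- The `p`-norm of a vector with entries in a normed field. -/
noncomputable def pNorm (p : ℝ≥0∞) (x : Fin n → K) : ℝ :=
  ‖WithLp.toLp p x‖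

/-- `dᵢ(x) = min_{j ≠ i} |xᵢ - xⱼ|` (the index set is finite, and nonempty when `n ≥ 2`). -/
noncomputable def sep (x : Fin n → K) (i : Fin n) : ℝ :=
  ⨅ j : {j : Fin n // j ≠ i}, ‖x i - x j‖

/-- The Weierstrass correction `Wᵢ(x) = f(xᵢ) / (a₀ ∏_{j ≠ i} (xᵢ - xⱼ))`, meaningful for
vectors `x` with distinct components. -/
noncomputable def W (f : Polynomial K) (x : Fin n → K) : Fin n → K :=
  fun i => f.eval (x i) / (f.leadingCoeff * ∏ j ∈ Finset.univ.erase i, (x i - x j))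

/-- `E_f(x) = ‖W_f(x) / d(x)‖_p`, where `x / y = (|x₁| / y₁, …, |xₙ| / yₙ)`. -/
noncomputable def E (p : ℝ≥0∞) (f : Polynomial K) (x : Fin n → K) : ℝ :=
  pNorm p (fun i => ‖W f x i‖ / sep x i)

/-- The iteration functions `T^{(N)}`: `T^{(0)}(x) = x` and
`Tᵢ^{(N+1)}(x) = xᵢ - f(xᵢ) / (a₀ ∏_{j ≠ i} (xᵢ - Tⱼ^{(N)}(x)))`.
The value at `x` is meaningful when `x` lies in `dom f N`. -/
noncomputable def T (f : Polynomial K) : ℕ → (Fin n → K) → (Fin n → K)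
  | 0, x => x
  | N + 1, x => fun i =>
      x i - f.eval (x i) / (f.leadingCoeff * ∏ j ∈ Finset.univ.erase i, (x i - T f N x j))

/-- The domains `D_N` of `T^{(N)}`: `D_0 = Kⁿ` and `D_{N+1} = {x ∈ D_N : x # T^{(N)}(x)}`. -/
def dom (f : Polynomial K) : ℕ → Set (Fin n → K)
  | 0 => Set.univ
  | N + 1 => {x | x ∈ dom f N ∧ Sharp x (T f N x)}

/-- The iteration `x^{(0)} = x₀`, `x^{(k+1)} = T^{(N)}(x^{(k)})`. -/
noncomputable def iter (f : Polynomial K) (N : ℕ) (x₀ : Fin n → K) (k : ℕ) : Fin n → K :=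
  (T f N)^[k] x₀

/-- The sequence `x` converges to `ξ` with order (at least) `r`:
`x^{(k)} → ξ` and `‖x^{(k+1)} - ξ‖_p ≤ C ‖x^{(k)} - ξ‖_p ^ r` for some constant `C` and all `k`. -/
def ConvergesWithOrder (p : ℝ≥0∞) (r : ℕ) (x : ℕ → Fin n → K) (ξ : Fin n → K) : Prop :=
  Tendsto x atTop (𝓝 ξ) ∧
    ∃ C : ℝ, ∀ k : ℕ, pNorm p (x (k + 1) - ξ) ≤ C * pNorm p (x k - ξ) ^ r

/-- `a = (n - 1)^{1/q}`; here `1/q = 0` for `q = ∞`. -/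
noncomputable def aConst (n : ℕ) (q : ℝ≥0∞) : ℝ :=
  ((n : ℝ) - 1) ^ (q⁻¹).toReal

/-- `α(t) = 2 / (1 - (a - 1) t + √((1 - (a - 1) t)² - 4 t))`. -/
noncomputable def alpha (a t : ℝ) : ℝ :=
  2 / (1 - (a - 1) * t + Real.sqrt ((1 - (a - 1) * t) ^ 2 - 4 * t))

/-- `c_n = n (2^{1/n} - 1)`. -/
noncomputable def cConst (n : ℕ) : ℝ :=
  n * ((2 : ℝ) ^ (1 / (n : ℝ)) - 1)

/-- `𝓡 = c_n (a + 2 - c_n) / ((a + 2) (a + 2 + (a - 1) c_n))`, with `c_n = n (2^{1/n} - 1)`. -/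
noncomputable def radius (n : ℕ) (a : ℝ) : ℝ :=
  cConst n * (a + 2 - cConst n) / ((a + 2) * (a + 2 + (a - 1) * cConst n))

end SimRoots

namespace SimRoots

/-! ### Elementary inequalities for products and powers -/

section Inequalities

/-! Write `τ = localRadius n a` and `B = errorFactor n a`. The radius in the theorem is chosen so
that `t < radius n a` means `s < τ`, where `s = t * alpha a t` is a root of `s (1 - s) = t (1 + (a -
1) s)` (`radius_eq`, `alpha_spec`).

Semilocal part: Lagrange interpolation at the components of `x` turns `f(z) = 0` near `xᵢ` into the
fixed point equation `z = xᵢ - Wᵢ / (1 + ∑_{j ≠ i} Wⱼ / (z - xⱼ))`. On the disc of radius `α |Wᵢ|`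
about `xᵢ` the right side is a contractive self-map, so the disc contains a zero of `f`. These zeros
are distinct, hence they are all the zeros of `f` and are simple (`exists_rootVector_near`), and the
relative error of `x⁽⁰⁾` is less than `τ`.

Local part: if the relative error is at most `λ τ` with `λ ≤ 1`, each Ehrlich-type correction gains
a factor `λ`, so `T^{(N)}` multiplies the error by at most `B λ ^ N` (`norm_T_sub_le`). The
inequality `(1 + B)(1 + 2 τ) ≤ 2` of `errorFactor_le` limits the loss of separation to the factor
`B`. This `B` cancels in the relative error, so the bound `λ τ` persists
(`injective_T_and_relError_le`). Taking for `λ` the current relative error divided by `τ` yields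
order `N + 1`. The error estimate at a later iterate is the semilocal part applied there, once its
root-vector is identified with the limit (`eq_of_near`). -/

theorem norm_prod_one_add_sub_one_le {K ι : Type*} [NormedField K] (s : Finset ι) (v : ι → K) :
    ‖∏ j ∈ s, (1 + v j) - 1‖ ≤ ∏ j ∈ s, (1 + ‖v j‖) - 1 := by
  classical
  induction s using Finset.induction_on with
  | empty => simp
  | insert i s hi ih =>
    rw [Finset.prod_insert hi, Finset.prod_insert hi]
    have h1 : ‖1 + v i‖ ≤ 1 + ‖v i‖ := by simpa using norm_add_le (1 : K) (v i)
    calc ‖(1 + v i) * ∏ j ∈ s, (1 + v j) - 1‖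
        = ‖(1 + v i) * (∏ j ∈ s, (1 + v j) - 1) + v i‖ := by congr 1; ring
      _ ≤ ‖1 + v i‖ * ‖∏ j ∈ s, (1 + v j) - 1‖ + ‖v i‖ := by
        rw [← norm_mul]; exact norm_add_le _ _
      _ ≤ (1 + ‖v i‖) * (∏ j ∈ s, (1 + ‖v j‖) - 1) + ‖v i‖ := by gcongr
      _ = _ := by ring

theorem prod_one_add_le_pow {ι : Type*} (s : Finset ι) (v : ι → ℝ) (hv : ∀ j ∈ s, 0 ≤ v j) :
    ∏ j ∈ s, (1 + v j) ≤ (1 + (∑ j ∈ s, v j) / s.card) ^ s.card := by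
  rcases s.eq_empty_or_nonempty with rfl | hs
  · simp
  have hm : (0 : ℝ) < s.card := by exact_mod_cast hs.card_pos
  have h := Real.geom_mean_le_arith_mean_weighted s (fun _ => (s.card : ℝ)⁻¹) (fun j => 1 + v j)
    (fun _ _ => by positivity) (by simp [hm.ne'])
    (fun j hj => by have := hv j hj; positivity)
  have h0 : ∀ j ∈ s, 0 ≤ 1 + v j := fun j hj => by have := hv j hj; positivity
  rw [Real.finsetProd_rpow _ _ h0, ← Finset.mul_sum, Finset.sum_add_distrib] at h
  have h2 := pow_le_pow_left₀ (Real.rpow_nonneg (Finset.prod_nonneg h0) _) h s.card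
  rw [Real.rpow_inv_natCast_pow (Finset.prod_nonneg h0) hs.card_pos.ne'] at h2
  refine h2.trans (le_of_eq ?_)
  congr 1
  simp only [Finset.sum_const, nsmul_eq_mul, mul_one]
  field_simp

/-- Convexity of `u ^ m` between `1` and `1 + y`. This pulls the small factor `θ` out of the error
bound linearly. -/
theorem one_add_mul_pow_sub_one_le {y θ : ℝ} (hy : 0 ≤ y) (h0 : 0 ≤ θ) (h1 : θ ≤ 1) (m : ℕ) :
    (1 + θ * y) ^ m - 1 ≤ θ * ((1 + y) ^ m - 1) := by
  have h := (convexOn_pow (𝕜 := ℝ) m).2 (x := 1) (y := 1 + y) (by simp) (by simp; linarith)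
    (sub_nonneg.2 h1) h0 (by ring)
  simp only [smul_eq_mul, one_pow, mul_one] at h
  have : 1 - θ + θ * (1 + y) = 1 + θ * y := by ring
  rw [this] at h
  linarith

/-- AM-GM for `m` copies of `x` and one `y`, obtained from Bernoulli's inequality at `M / x - 1`
with `M` the mean. -/
theorem pow_mul_le_mean_pow {x y : ℝ} (hx : 0 < x) (hy : 0 ≤ y) (m : ℕ) :
    x ^ m * y ≤ ((m * x + y) / (m + 1)) ^ (m + 1) := by
  set M := (m * x + y) / (m + 1) with hM
  have hM0 : 0 ≤ M := by positivity
  have h := one_add_mul_le_pow (R := ℝ) (a := M / x - 1)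
    (by have : 0 ≤ M / x := by positivity
        linarith) (m + 1)
  have e : 1 + ((m + 1 : ℕ) : ℝ) * (M / x - 1) = y / x := by
    rw [hM]; push_cast; field_simp; ring
  rw [e, add_sub_cancel, div_pow, div_le_div_iff₀ hx (by positivity)] at h
  have h' : x * (x ^ m * y) ≤ x * M ^ (m + 1) := by
    calc _ = y * x ^ (m + 1) := by ring
      _ ≤ _ := h
      _ = _ := by ring
  exact le_of_mul_le_mul_left h' hx

end Inequalities

/-! ### The constants: local radius, error factor, and inversion by `alpha` -/

section Constants

variable {n : ℕ}

theorem one_add_cConst_div_pow (hn : 2 ≤ n) : (1 + cConst n / n) ^ n = 2 := by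
  have h : (n : ℝ) ≠ 0 := by positivity
  have e : 1 + cConst n / n = (2 : ℝ) ^ ((n : ℝ)⁻¹) := by
    unfold cConst; field_simp; ring
  rw [e, Real.rpow_inv_natCast_pow (by norm_num) (by omega)]

theorem cConst_pos (hn : 2 ≤ n) : 0 < cConst n := by
  have h : (0 : ℝ) < n := by positivity
  have : (1 : ℝ) < (2 : ℝ) ^ (1 / (n : ℝ)) := Real.one_lt_rpow (by norm_num) (by positivity)
  unfold cConst
  exact mul_pos h (by linarith)

theorem cConst_lt_one (hn : 2 ≤ n) : cConst n < 1 := by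
  have hn0 : (0 : ℝ) < n := by positivity
  by_contra! h
  obtain ⟨m, rfl⟩ : ∃ m, n = m + 2 := ⟨n - 2, by omega⟩
  -- Bernoulli for all `n` factors gives only `2 ≤ (1 + 1/n) ^ n`. Keeping one factor aside gives a
  -- strict inequality.
  have h1 := one_add_mul_le_pow (R := ℝ) (a := 1 / ((m + 2 : ℕ) : ℝ))
    (by have : (0 : ℝ) ≤ 1 / ((m + 2 : ℕ) : ℝ) := by positivity
        linarith) (m + 1)
  have h2 := one_add_cConst_div_pow hn
  have h3 : (1 + 1 / ((m + 2 : ℕ) : ℝ)) ^ (m + 2) ≤ 2 := by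
    rw [← h2]; gcongr
  rw [pow_succ] at h3
  have h4 : (1 + ((m + 1 : ℕ) : ℝ) * (1 / ((m + 2 : ℕ) : ℝ))) * (1 + 1 / ((m + 2 : ℕ) : ℝ)) ≤ 2 :=
    le_trans (by gcongr) h3
  push_cast at h4
  have : (1 + ((m : ℝ) + 1) * (1 / (m + 2))) * (1 + 1 / (m + 2))
      = 2 + (m + 1) / ((m : ℝ) + 2) ^ 2 := by
    field_simp; ring
  rw [this] at h4
  have : 0 < (m + 1) / ((m : ℝ) + 2) ^ 2 := by positivity
  linarith

theorem one_le_aConst (hn : 2 ≤ n) (q : ℝ≥0∞) : 1 ≤ aConst n q := by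
  have : (2 : ℝ) ≤ n := by exact_mod_cast hn
  exact Real.one_le_rpow (by linarith) ENNReal.toReal_nonneg

/-- The local convergence radius `c_n / (a + 2)`. -/
noncomputable def localRadius (n : ℕ) (a : ℝ) : ℝ := cConst n / (a + 2)

/-- The error factor of the Weierstrass step at the local convergence radius. -/
noncomputable def errorFactor (n : ℕ) (a : ℝ) : ℝ :=
  (1 + a * localRadius n a / (n - 1 : ℕ)) ^ (n - 1) - 1

theorem localRadius_pos (hn : 2 ≤ n) {a : ℝ} (ha : 1 ≤ a) : 0 < localRadius n a :=
  div_pos (cConst_pos hn) (by linarith)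

theorem localRadius_lt (hn : 2 ≤ n) {a : ℝ} (ha : 1 ≤ a) : localRadius n a < 1 / (a + 2) :=
  div_lt_div_of_pos_right (cConst_lt_one hn) (by linarith)

theorem localRadius_lt_third (hn : 2 ≤ n) {a : ℝ} (ha : 1 ≤ a) : localRadius n a < 1 / 3 :=
  (localRadius_lt hn ha).trans_le (one_div_le_one_div_of_le (by norm_num) (by linarith))

theorem radius_eq (hn : 2 ≤ n) {a : ℝ} (ha : 1 ≤ a) :
    radius n a = localRadius n a * (1 - localRadius n a) / (1 + (a - 1) * localRadius n a) := by
  have hc := cConst_pos hn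
  have h1 : 0 < a + 2 := by linarith
  have h2 : 0 ≤ (a - 1) * cConst n := mul_nonneg (by linarith) hc.le
  have h3 : 0 < a + 2 + (a - 1) * cConst n := by linarith
  have h4 : 1 + (a - 1) * (cConst n / (a + 2)) ≠ 0 := by
    have : 1 + (a - 1) * (cConst n / (a + 2)) = (a + 2 + (a - 1) * cConst n) / (a + 2) := by
      field_simp
    rw [this]; positivity
  unfold radius localRadius
  rw [div_eq_div_iff (by positivity) h4]
  field_simp

theorem errorFactor_pos (hn : 2 ≤ n) {a : ℝ} (ha : 1 ≤ a) : 0 < errorFactor n a := by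
  have h1 : (0 : ℝ) < (n - 1 : ℕ) := by exact_mod_cast (by omega : 0 < n - 1)
  have h2 := localRadius_pos hn ha
  have : 1 < (1 + a * localRadius n a / (n - 1 : ℕ)) ^ (n - 1) :=
    one_lt_pow₀ (by have : 0 < a * localRadius n a / (n - 1 : ℕ) := by positivity
                    linarith) (by omega)
  unfold errorFactor; linarith

/-- This is `(1 + B)(1 + 2 τ) ≤ 2` for the error factor `B` and local radius `τ`. The left side is a
product of `n - 1` factors `1 + a τ / (n - 1)` and one factor `1 + 2 τ`, whose mean is `1 + c_n / n
= 2 ^ (1 / n)`; AM-GM concludes. This is what dictates the value `τ = c_n / (a + 2)`. -/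
theorem errorFactor_le (hn : 2 ≤ n) {a : ℝ} (ha : 1 ≤ a) :
    errorFactor n a ≤ 1 - 2 * (1 + errorFactor n a) * localRadius n a := by
  have h2 := localRadius_pos hn ha
  obtain ⟨m, rfl⟩ : ∃ m, n = m + 1 := ⟨n - 1, by omega⟩
  have h1 : (0 : ℝ) < m := by exact_mod_cast (by omega : 0 < m)
  have h := pow_mul_le_mean_pow (x := 1 + a * localRadius (m + 1) a / m)
    (y := 1 + 2 * localRadius (m + 1) a) (by positivity) (by positivity) m
  have e : (m * (1 + a * localRadius (m + 1) a / m) + (1 + 2 * localRadius (m + 1) a)) / (m + 1)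
      = 1 + cConst (m + 1) / (m + 1 : ℕ) := by
    have : 0 < a + 2 := by linarith
    unfold localRadius; push_cast; field_simp; ring
  rw [e, one_add_cConst_div_pow hn] at h
  simp only [errorFactor, Nat.add_sub_cancel]
  linarith

/-- `s = t α(t)` inverts `t = s (1 - s) / (1 + (a - 1) s)`. -/
theorem alpha_spec (hn : 2 ≤ n) {a t : ℝ} (ha : 1 ≤ a) (ht : 0 ≤ t) (h : t ≤ radius n a) :
    0 < alpha a t ∧ 0 ≤ t * alpha a t ∧ t * alpha a t ≤ localRadius n a ∧
      (t < radius n a → t * alpha a t < localRadius n a) ∧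
      alpha a t * (1 - t * alpha a t) = 1 + (a - 1) * (t * alpha a t) := by
  have hτ := localRadius_pos hn ha
  have hτ1 := localRadius_lt_third hn ha
  rw [radius_eq hn ha]
  rw [radius_eq hn ha] at h
  set τ := localRadius n a
  have hd : 0 < 1 + (a - 1) * τ := by nlinarith
  rw [lt_div_iff₀ hd]
  rw [le_div_iff₀ hd] at h
  set A := 1 - (a - 1) * t with hA
  have hA0 : 0 < A := by
    rw [hA]
    by_contra! hneg
    have : τ * 1 ≤ τ * ((a - 1) * t) := mul_le_mul_of_nonneg_left (by linarith) hτ.le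
    nlinarith
  -- Equivalent to `t (1 + (a - 1) τ) ≤ τ (1 - τ)`, which is `h`. It places `τ` between the two
  -- roots of `s ^ 2 - A s + t`, the smaller of which is `t * alpha a t`.
  have hq : (2 * τ - A) ^ 2 ≤ A ^ 2 - 4 * t := by rw [hA]; nlinarith
  have hD : 0 ≤ A ^ 2 - 4 * t := (sq_nonneg _).trans hq
  have hα : alpha a t = 2 / (A + √(A ^ 2 - 4 * t)) := rfl
  have hS := Real.sqrt_nonneg (A ^ 2 - 4 * t)
  have hS2 := Real.sq_sqrt hD
  set S := √(A ^ 2 - 4 * t) with hSdef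
  have hAS : 0 < A + S := by linarith
  have hs : t * alpha a t = (A - S) / 2 := by
    rw [hα]; field_simp; nlinarith
  have hSA : S ≤ A := by
    rw [hSdef]; exact Real.sqrt_le_iff.2 ⟨hA0.le, by linarith⟩
  refine ⟨by rw [hα]; positivity, by rw [hs]; linarith, ?_, ?_, ?_⟩
  · rw [hs]
    have := Real.abs_le_sqrt hq
    have := (abs_le.1 this).1
    linarith
  · intro hlt
    rw [hs]
    have hq' : (2 * τ - A) ^ 2 < A ^ 2 - 4 * t := by rw [hA]; nlinarith
    have := Real.lt_sqrt_of_sq_lt (x := A - 2 * τ) (by linarith [hq'] : (A - 2 * τ) ^ 2 < A ^ 2 - 4 * t)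
    linarith
  · have : alpha a t * (A + S) = 2 := by rw [hα]; field_simp
    have h3 : alpha a t * (1 - (A - S) / 2) - (a - 1) * ((A - S) / 2)
        = alpha a t * (A + S) / 2 + alpha a t * (1 - A) - (a - 1) * ((A - S) / 2) := by ring
    have h4 : alpha a t * (1 - A) = (a - 1) * (t * alpha a t) := by rw [hA]; ring
    rw [hs] at h4 ⊢
    linarith

end Constants

/-! ### Monotonicity of the `p`-norm and Hölder's inequality -/

section Norms

variable {n : ℕ} {p q : ℝ≥0∞}

theorem pNorm_mono {F G : Type*} [NormedField F] [NormedField G] (hp : 1 ≤ p)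
    {x : Fin n → F} {y : Fin n → G} (h : ∀ i, ‖x i‖ ≤ ‖y i‖) : pNorm p x ≤ pNorm p y := by
  unfold pNorm
  rcases eq_or_ne p ∞ with rfl | hp'
  · rw [PiLp.norm_eq_ciSup, PiLp.norm_eq_ciSup]
    exact ciSup_mono (Set.finite_range _).bddAbove h
  · have hp0 : 0 < p.toReal := ENNReal.toReal_pos (by positivity) hp'
    rw [PiLp.norm_eq_sum hp0, PiLp.norm_eq_sum hp0]
    refine Real.rpow_le_rpow (Finset.sum_nonneg fun i _ => by positivity)
      (Finset.sum_le_sum fun i _ => ?_) (by positivity)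
    exact Real.rpow_le_rpow (norm_nonneg _) (h i) hp0.le

theorem pNorm_nonneg {F : Type*} [NormedField F] (hp : 1 ≤ p) (x : Fin n → F) : 0 ≤ pNorm p x :=
  have : Fact (1 ≤ p) := ⟨hp⟩
  norm_nonneg _

theorem norm_le_pNorm {F : Type*} [NormedField F] (hp : 1 ≤ p) (x : Fin n → F) (i : Fin n) :
    ‖x i‖ ≤ pNorm p x :=
  have : Fact (1 ≤ p) := ⟨hp⟩
  PiLp.norm_apply_le (WithLp.toLp p x) i

theorem pNorm_le_mul {F G : Type*} [NormedField F] [NormedField G] (hp : 1 ≤ p)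
    {x : Fin n → F} {y : Fin n → G} {r : ℝ} (hr : 0 ≤ r) (h : ∀ i, ‖x i‖ ≤ r * ‖y i‖) :
    pNorm p x ≤ r * pNorm p y := by
  have : Fact (1 ≤ p) := ⟨hp⟩
  have h1 : pNorm p x ≤ pNorm p (fun i => r * ‖y i‖) :=
    pNorm_mono hp fun i => by rw [Real.norm_of_nonneg (by positivity)]; exact h i
  have h2 : pNorm p (fun i => r * ‖y i‖) = r * pNorm p (fun i => ‖y i‖) := by
    have := norm_smul r (WithLp.toLp p (fun i => ‖y i‖))
    rwa [Real.norm_of_nonneg hr] at this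
  rw [h2] at h1
  exact h1.trans (mul_le_mul_of_nonneg_left (pNorm_mono hp fun i => by simp) hr)

/-- Hölder's inequality against the constant vector `1` on `n - 1` indices, whose `q`-norm is the
constant `a`. The endpoints `p = ∞` and `p = 1` are treated directly because the real conjugate
exponents require `1 < p < ∞`. -/
theorem sum_erase_le_aConst_mul_pNorm (hn : 2 ≤ n) (hp : 1 ≤ p) (hpq : p⁻¹ + q⁻¹ = 1)
    {u : Fin n → ℝ} (hu : ∀ i, 0 ≤ u i) (i : Fin n) :
    ∑ j ∈ Finset.univ.erase i, u j ≤ aConst n q * pNorm p u := by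
  have hcard : ((Finset.univ.erase i).card : ℝ) = (n : ℝ) - 1 := by
    rw [Finset.card_erase_of_mem (Finset.mem_univ _), Finset.card_univ, Fintype.card_fin,
      Nat.cast_sub (by omega), Nat.cast_one]
  unfold aConst
  rcases eq_or_ne p ∞ with rfl | hp'
  · have : q⁻¹ = 1 := by simpa using hpq
    rw [this, ENNReal.toReal_one, Real.rpow_one, ← hcard, ← nsmul_eq_mul]
    refine Finset.sum_le_card_nsmul _ _ _ fun j _ => ?_
    exact (le_abs_self _).trans (norm_le_pNorm hp u j)
  have hp0 : 0 < p.toReal := ENNReal.toReal_pos (by positivity) hp'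
  rcases hp.eq_or_lt with rfl | hp1
  · have : q⁻¹ = 0 := by
      have h : (1 : ℝ≥0∞) + q⁻¹ = 1 + 0 := by simpa using hpq
      exact (ENNReal.add_right_inj ENNReal.one_ne_top).1 h
    rw [this, ENNReal.toReal_zero, Real.rpow_zero, one_mul, pNorm, PiLp.norm_eq_sum hp0]
    simp only [ENNReal.toReal_one, Real.rpow_one, div_one, Real.norm_eq_abs]
    refine (Finset.sum_le_sum fun j _ => le_abs_self (u j)).trans ?_
    exact Finset.sum_le_sum_of_subset_of_nonneg (Finset.erase_subset _ _) fun _ _ _ => abs_nonneg _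
  · have hq : p.toReal⁻¹ + (q⁻¹).toReal = 1 := by
      have hq' : q⁻¹ ≠ ∞ := fun h => by rw [h] at hpq; simp at hpq
      rw [← ENNReal.toReal_inv, ← ENNReal.toReal_add (ENNReal.inv_ne_top.2 (by positivity)) hq', hpq,
        ENNReal.toReal_one]
    have hp1' : 1 < p.toReal := by
      rw [← ENNReal.toReal_one]; exact (ENNReal.toReal_lt_toReal ENNReal.one_ne_top hp').2 hp1
    have hqe : (Real.conjExponent p.toReal)⁻¹ = (q⁻¹).toReal := by
      have := (Real.HolderConjugate.conjExponent hp1').inv_add_inv_eq_one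
      linarith
    have h := Real.inner_le_Lp_mul_Lq_of_nonneg (Finset.univ.erase i)
      (Real.HolderConjugate.conjExponent hp1') (f := u) (g := fun _ => 1)
      (fun j _ => hu j) (fun _ _ => zero_le_one)
    simp only [mul_one, Real.one_rpow, Finset.sum_const, nsmul_eq_mul, hcard] at h
    rw [one_div (Real.conjExponent _), hqe] at h
    refine h.trans ?_
    rw [mul_comm, pNorm, PiLp.norm_eq_sum hp0]
    have hn' : (0 : ℝ) ≤ (n : ℝ) - 1 := by rw [← hcard]; positivity
    refine mul_le_mul_of_nonneg_left ?_ (Real.rpow_nonneg hn' _)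
    refine Real.rpow_le_rpow (Finset.sum_nonneg fun j _ => Real.rpow_nonneg (hu j) _) ?_
      (by positivity)
    simp only [Real.norm_of_nonneg (hu _)]
    exact Finset.sum_le_sum_of_subset_of_nonneg (Finset.erase_subset _ _)
      fun j _ _ => Real.rpow_nonneg (hu j) _

end Norms

/-! ### Distance to the nearest other component -/

section Separation

variable {K : Type*} [NormedField K] {n : ℕ}

theorem sep_le {x : Fin n → K} {i j : Fin n} (h : j ≠ i) : sep x i ≤ ‖x i - x j‖ :=
  ciInf_le (f := fun j : {j : Fin n // j ≠ i} => ‖x i - x j‖) (Set.finite_range _).bddBelow ⟨j, h⟩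

theorem le_sep (hn : 2 ≤ n) {x : Fin n → K} {i : Fin n} {r : ℝ}
    (h : ∀ j, j ≠ i → r ≤ ‖x i - x j‖) : r ≤ sep x i := by
  have : Nontrivial (Fin n) := Fin.nontrivial_iff_two_le.2 hn
  obtain ⟨j, hj⟩ := exists_ne i
  have : Nonempty {j : Fin n // j ≠ i} := ⟨⟨j, hj⟩⟩
  exact le_ciInf fun j => h j j.2

theorem sep_nonneg (hn : 2 ≤ n) (x : Fin n → K) (i : Fin n) : 0 ≤ sep x i :=
  le_sep hn fun _ _ => norm_nonneg _

theorem sep_pos (hn : 2 ≤ n) {x : Fin n → K} (hx : Function.Injective x) (i : Fin n) :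
    0 < sep x i := by
  have : Nontrivial (Fin n) := Fin.nontrivial_iff_two_le.2 hn
  obtain ⟨j, hj⟩ := exists_ne i
  have : Nonempty {j : Fin n // j ≠ i} := ⟨⟨j, hj⟩⟩
  obtain ⟨k, hk⟩ := exists_eq_ciInf_of_finite (f := fun j : {j : Fin n // j ≠ i} => ‖x i - x j‖)
  unfold sep
  rw [← hk]
  exact norm_pos_iff.2 (sub_ne_zero.2 fun h => k.2 (hx h).symm)

end Separation

end SimRoots

namespace SimRoots

/-! ### Existence of a root-vector near a vector with small `E_f` -/

section Semilocal

open Polynomial in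
-- A substitute for Banach's fixed point theorem, since `K` need not be complete. Along the orbit of
-- `c` the values of `f` tend to `0`. If no zero lay in the disc, each linear factor of `f`, and
-- hence `f`, would be bounded away from `0` there.
theorem exists_isRoot_of_contraction {K : Type*} [NormedField K] [IsAlgClosed K] {f : K[X]}
    (hf : f ≠ 0) {c : K} {r κ C : ℝ} (φ : K → K) (hr : 0 ≤ r)
    (hmaps : ∀ z, ‖z - c‖ ≤ r → ‖φ z - c‖ ≤ r) (hκ0 : 0 ≤ κ) (hκ : κ < 1)
    (hcontr : ∀ y z, ‖y - c‖ ≤ r → ‖z - c‖ ≤ r → ‖φ y - φ z‖ ≤ κ * ‖y - z‖) (hC : 0 ≤ C)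
    (hfφ : ∀ z, ‖z - c‖ ≤ r → ‖f.eval z‖ ≤ C * ‖z - φ z‖) :
    ∃ z, ‖z - c‖ ≤ r ∧ f.IsRoot z := by
  by_contra! hno
  have hlow : ∀ s : Multiset K, (∀ ξ ∈ s, r < ‖ξ - c‖) →
      ∃ ε > 0, ∀ z, ‖z - c‖ ≤ r → ε ≤ ‖(s.map (fun ξ => z - ξ)).prod‖ := by
    intro s
    induction s using Multiset.induction_on with
    | empty => exact fun _ => ⟨1, one_pos, fun z _ => by simp⟩
    | cons ξ s ih =>
      intro h
      obtain ⟨ε, hε, hs⟩ := ih fun η hη => h η (Multiset.mem_cons_of_mem hη)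
      have hξ : 0 < ‖ξ - c‖ - r := sub_pos.2 (h ξ (Multiset.mem_cons_self ξ s))
      refine ⟨(‖ξ - c‖ - r) * ε, by positivity, fun z hz => ?_⟩
      rw [Multiset.map_cons, Multiset.prod_cons, norm_mul]
      have h1 : ‖ξ - c‖ - r ≤ ‖z - ξ‖ := by
        have := norm_sub_le_norm_sub_add_norm_sub ξ z c
        rw [norm_sub_rev ξ z] at this
        linarith
      exact mul_le_mul h1 (hs z hz) hε.le (norm_nonneg _)
  obtain ⟨ε, hε, hlow⟩ := hlow f.roots fun ξ hξ =>
    lt_of_not_ge fun h => hno ξ h (isRoot_of_mem_roots hξ)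
  have hz : ∀ k, ‖φ^[k] c - c‖ ≤ r := by
    intro k
    induction k with
    | zero => simpa using hr
    | succ k ih => rw [Function.iterate_succ_apply']; exact hmaps _ ih
  have hd : ∀ k, ‖φ^[k] c - φ (φ^[k] c)‖ ≤ κ ^ k * ‖c - φ c‖ := by
    intro k
    induction k with
    | zero => simp
    | succ k ih =>
      rw [Function.iterate_succ_apply']
      refine (hcontr _ _ (hz k) (hmaps _ (hz k))).trans ?_
      rw [pow_succ', mul_assoc]
      exact mul_le_mul_of_nonneg_left ih hκ0
  have hev : ∀ k, ‖f.leadingCoeff‖ * ε ≤ C * (κ ^ k * ‖c - φ c‖) := by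
    intro k
    refine le_trans ?_ ((hfφ _ (hz k)).trans (mul_le_mul_of_nonneg_left (hd k) hC))
    have : f.eval (φ^[k] c) = f.leadingCoeff * (f.roots.map (fun ξ => φ^[k] c - ξ)).prod := by
      conv_lhs => rw [(IsAlgClosed.splits f).eq_prod_roots]
      rw [eval_mul, eval_C, eval_multiset_prod, Multiset.map_map]
      simp
    rw [this, norm_mul]
    exact mul_le_mul_of_nonneg_left (hlow _ (hz k)) (norm_nonneg _)
  have hlim : Tendsto (fun k => C * (κ ^ k * ‖c - φ c‖)) atTop (𝓝 0) := by
    simpa using ((tendsto_pow_atTop_nhds_zero_of_lt_one hκ0 hκ).mul_const ‖c - φ c‖).const_mul C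
  have := ge_of_tendsto' hlim hev
  have : 0 < ‖f.leadingCoeff‖ * ε := mul_pos (norm_pos_iff.2 (leadingCoeff_ne_zero.2 hf)) hε
  linarith

variable {K : Type*} [NormedField K] {n : ℕ} {f : Polynomial K} {x : Fin n → K}

open Polynomial in
-- Lagrange interpolation: `f - a₀ ∏ (z - xⱼ)` has degree below `n`, and both sides agree at the `n`
-- nodes `xᵢ`.
theorem eval_eq_weierstrass (hn : 2 ≤ n) (hf : f.natDegree = n) (hx : Function.Injective x)
    (z : K) :
    f.eval z = f.leadingCoeff *
      (∏ j, (z - x j) + ∑ k, W f x k * ∏ j ∈ Finset.univ.erase k, (z - x j)) := by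
  have hf0 : f ≠ 0 := by rintro rfl; simp at hf; omega
  have hlc : f.leadingCoeff ≠ 0 := leadingCoeff_ne_zero.2 hf0
  have hdeg : f.degree = n := by rw [degree_eq_natDegree hf0, hf]
  have hmonic : (∏ j, (X - C (x j))).Monic := monic_prod_of_monic _ _ fun j _ => monic_X_sub_C _
  have hnod : (C f.leadingCoeff * ∏ j, (X - C (x j))).degree = n := by
    rw [degree_mul, degree_C hlc, degree_prod]; simp
  have key : f - C f.leadingCoeff * ∏ j, (X - C (x j)) =
      C f.leadingCoeff * ∑ k, C (W f x k) * ∏ j ∈ Finset.univ.erase k, (X - C (x j)) := by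
    refine eq_of_degrees_lt_of_eval_index_eq (v := x) Finset.univ hx.injOn ?_ ?_ ?_
    · rw [Finset.card_univ, Fintype.card_fin]
      refine (degree_sub_lt_left (hdeg.trans hnod.symm) hf0 ?_).trans_eq hdeg
      rw [leadingCoeff_mul, leadingCoeff_C, hmonic.leadingCoeff, mul_one]
    · rw [Finset.card_univ, Fintype.card_fin]
      refine (degree_C_mul hlc).trans_lt ?_
      refine (degree_sum_le _ _).trans_lt ?_
      rw [Finset.sup_lt_iff (by exact WithBot.bot_lt_coe n)]
      intro k _
      refine ((degree_mul_le _ _).trans (add_le_add degree_C_le le_rfl)).trans_lt ?_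
      rw [zero_add]
      rw [degree_prod]
      simp only [degree_X_sub_C, Finset.sum_const, nsmul_eq_mul, mul_one,
        Finset.card_erase_of_mem (Finset.mem_univ k), Finset.card_univ, Fintype.card_fin]
      exact_mod_cast (by omega : n - 1 < n)
    · intro i _
      have h1 : ∏ j ∈ Finset.univ.erase i, (x i - x j) ≠ 0 :=
        Finset.prod_ne_zero_iff.2 fun j hj => sub_ne_zero.2 fun h =>
          (Finset.ne_of_mem_erase hj) (hx h).symm
      have h2 : ∏ j, (x i - x j) = 0 := Finset.prod_eq_zero (Finset.mem_univ i) (sub_self _)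
      simp only [eval_sub, eval_mul, eval_C, eval_prod, eval_X, eval_finsetSum, h2, mul_zero,
        sub_zero]
      rw [Finset.sum_eq_single i]
      · unfold W; field_simp
      · intro k _ hk
        rw [Finset.prod_eq_zero (Finset.mem_erase.2 ⟨hk.symm, Finset.mem_univ i⟩) (sub_self _),
          mul_zero]
      · simp
  have := congrArg (eval z) (sub_eq_iff_eq_add'.1 key)
  simpa [eval_prod, eval_finsetSum, mul_add] using this

theorem eval_eq_weierstrass_at (hn : 2 ≤ n) (hf : f.natDegree = n) (hx : Function.Injective x)
    (i : Fin n) {z : K} (hz : ∀ j, j ≠ i → z - x j ≠ 0) :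
    f.eval z = f.leadingCoeff * (∏ j ∈ Finset.univ.erase i, (z - x j)) *
      ((z - x i) * (1 + ∑ j ∈ Finset.univ.erase i, W f x j / (z - x j)) + W f x i) := by
  rw [eval_eq_weierstrass hn hf hx, ← Finset.mul_prod_erase _ _ (Finset.mem_univ i),
    ← Finset.add_sum_erase _ _ (Finset.mem_univ i)]
  have h : ∑ k ∈ Finset.univ.erase i, W f x k * ∏ j ∈ Finset.univ.erase k, (z - x j) =
      (z - x i) * (∏ j ∈ Finset.univ.erase i, (z - x j)) *
        ∑ k ∈ Finset.univ.erase i, W f x k / (z - x k) := by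
    rw [Finset.mul_sum]
    refine Finset.sum_congr rfl fun k hk => ?_
    have hk' := hz k (Finset.ne_of_mem_erase hk)
    rw [Finset.mul_prod_erase _ (fun j => z - x j) (Finset.mem_univ i),
      ← Finset.mul_prod_erase _ (fun j => z - x j) (Finset.mem_univ k)]
    field_simp
  rw [h]; ring

theorem eval_eq_of_isRoot (hn : 2 ≤ n) (hf : f.natDegree = n) {ξ : Fin n → K}
    (hξ : Function.Injective ξ) (h : ∀ i, f.IsRoot (ξ i)) (z : K) :
    f.eval z = f.leadingCoeff * ∏ i, (z - ξ i) := by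
  have hW : ∀ k, W f ξ k = 0 := fun k => by unfold W; rw [(h k).eq_zero, zero_div]
  rw [eval_eq_weierstrass hn hf hξ]
  simp [hW]

/-- The root multiset has at most `n` elements, so `n` distinct roots exhaust it. -/
theorem onlySimpleZeros_of_isRoot (hn : 2 ≤ n) (hf : f.natDegree = n) {ξ : Fin n → K}
    (hξ : Function.Injective ξ) (h : ∀ i, f.IsRoot (ξ i)) : OnlySimpleZeros f := by
  classical
  have hf0 : f ≠ 0 := by rintro rfl; simp at hf; omega
  have hnd : (Finset.univ.val.map ξ).Nodup := Finset.univ.nodup.map hξ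
  have hle : Finset.univ.val.map ξ ≤ f.roots := by
    rw [Multiset.le_iff_subset hnd]
    intro z hz
    obtain ⟨i, -, rfl⟩ := Multiset.mem_map.1 hz
    exact (Polynomial.mem_roots hf0).2 (h i)
  have heq := Multiset.eq_of_le_of_card_le hle (by
    simpa [hf] using f.card_roots')
  intro z hz
  rw [← Polynomial.count_roots, ← heq]
  exact Multiset.count_eq_one_of_mem hnd (heq ▸ (Polynomial.mem_roots hf0).2 hz)

theorem exists_isRoot_near [IsAlgClosed K] (hn : 2 ≤ n) (hf : f.natDegree = n)
    (hx : Function.Injective x) {a t α : ℝ} (ha : 1 ≤ a) (hα : 0 < α)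
    (hs0 : 0 ≤ t * α) (hs : t * α < 1 / (a + 2))
    (hαeq : α * (1 - t * α) = 1 + (a - 1) * (t * α))
    (hW : ∀ i, ‖W f x i‖ / sep x i ≤ t)
    (hsum : ∀ i, ∑ j ∈ Finset.univ.erase i, ‖W f x j‖ / sep x j ≤ a * t) (i : Fin n) :
    ∃ z, ‖z - x i‖ ≤ α * ‖W f x i‖ ∧ f.IsRoot z := by
  have hf0 : f ≠ 0 := by rintro rfl; simp at hf; omega
  have hsep := sep_pos hn hx
  have ht : 0 ≤ t := nonneg_of_mul_nonneg_left hs0 hα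
  obtain ⟨s, hsdef⟩ : ∃ s, s = t * α := ⟨_, rfl⟩
  rw [← hsdef] at hs0 hs hαeq
  have ha2 : 0 < a + 2 := by linarith
  have hs' : s * (a + 2) < 1 := by rwa [lt_div_iff₀ ha2] at hs
  have hs1 : 0 < 1 - s := by nlinarith
  -- The quadratic relation for `α` is exactly what makes the lower bound for `|1 + S z|` equal to
  -- `1 / α`, so the disc of radius `α |Wᵢ|` is mapped into itself.
  have hkey : 1 - a * t / (1 - s) = 1 / α := by
    have h : a * t * α = a * s := by rw [hsdef]; ring
    rw [eq_div_iff hα.ne', sub_mul, div_mul_eq_mul_div, h]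
    field_simp
    linarith
  have hr : α * ‖W f x i‖ ≤ s * sep x i := by
    have := (div_le_iff₀ (hsep i)).1 (hW i)
    rw [hsdef]; nlinarith
  have hfar : ∀ z, ‖z - x i‖ ≤ α * ‖W f x i‖ → ∀ j, j ≠ i →
      (1 - s) * ‖x i - x j‖ ≤ ‖z - x j‖ := by
    intro z hz j hj
    have h1 := norm_sub_le_norm_sub_add_norm_sub (x i) z (x j)
    rw [norm_sub_rev (x i) z] at h1
    have h2 := mul_le_mul_of_nonneg_left (sep_le (x := x) hj) hs0
    linarith
  have hfar_i : ∀ z, ‖z - x i‖ ≤ α * ‖W f x i‖ → ∀ j, j ≠ i → (1 - s) * sep x i ≤ ‖z - x j‖ :=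
    fun z hz j hj => (mul_le_mul_of_nonneg_left (sep_le hj) hs1.le).trans (hfar z hz j hj)
  have hfar_j : ∀ z, ‖z - x i‖ ≤ α * ‖W f x i‖ → ∀ j, j ≠ i → (1 - s) * sep x j ≤ ‖z - x j‖ :=
    fun z hz j hj => (mul_le_mul_of_nonneg_left
      ((sep_le hj.symm).trans_eq (norm_sub_rev _ _)) hs1.le).trans (hfar z hz j hj)
  have hne : ∀ z, ‖z - x i‖ ≤ α * ‖W f x i‖ → ∀ j, j ≠ i → z - x j ≠ 0 := fun z hz j hj =>
    norm_pos_iff.1 ((mul_pos hs1 (hsep i)).trans_le (hfar_i z hz j hj))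
  obtain ⟨S, hS⟩ : ∃ S : K → K, S = fun z => ∑ j ∈ Finset.univ.erase i, W f x j / (z - x j) :=
    ⟨_, rfl⟩
  have hSnorm : ∀ z, ‖z - x i‖ ≤ α * ‖W f x i‖ → ‖S z‖ ≤ a * t / (1 - s) := by
    intro z hz
    rw [hS]
    refine (norm_sum_le _ _).trans ?_
    refine le_trans (Finset.sum_le_sum (g := fun j => (‖W f x j‖ / sep x j) / (1 - s))
      fun j hj => ?_) ?_
    · rw [norm_div, div_div, mul_comm (sep x j)]
      have := mul_pos hs1 (hsep j)
      exact div_le_div_of_nonneg_left (norm_nonneg _) this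
        (hfar_j z hz j (Finset.ne_of_mem_erase hj))
    · rw [← Finset.sum_div]
      exact div_le_div_of_nonneg_right (hsum i) hs1.le
  have hSlow : ∀ z, ‖z - x i‖ ≤ α * ‖W f x i‖ → 1 / α ≤ ‖1 + S z‖ := by
    intro z hz
    have h1 := norm_sub_norm_le (1 : K) (-S z)
    rw [norm_neg, norm_one, sub_neg_eq_add] at h1
    linarith [hSnorm z hz]
  have hSne : ∀ z, ‖z - x i‖ ≤ α * ‖W f x i‖ → 1 + S z ≠ 0 := fun z hz =>
    norm_pos_iff.1 ((one_div_pos.2 hα).trans_le (hSlow z hz))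
  have hSinv : ∀ z, ‖z - x i‖ ≤ α * ‖W f x i‖ → ‖1 + S z‖⁻¹ ≤ α := by
    intro z hz
    have := inv_anti₀ (one_div_pos.2 hα) (hSlow z hz)
    simpa using this
  have hSlip : ∀ y z, ‖y - x i‖ ≤ α * ‖W f x i‖ → ‖z - x i‖ ≤ α * ‖W f x i‖ →
      ‖S z - S y‖ ≤ a * t / ((1 - s) * ((1 - s) * sep x i)) * ‖y - z‖ := by
    intro y z hy hz
    rw [hS]
    simp only
    rw [← Finset.sum_sub_distrib]
    refine (norm_sum_le _ _).trans ?_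
    refine le_trans (Finset.sum_le_sum (g := fun j =>
      (‖W f x j‖ / sep x j) * (‖y - z‖ / ((1 - s) * ((1 - s) * sep x i)))) fun j hj => ?_) ?_
    · have hj' := Finset.ne_of_mem_erase hj
      have e : W f x j / (z - x j) - W f x j / (y - x j)
          = W f x j * (y - z) / ((z - x j) * (y - x j)) := by
        have h1 := hne z hz j hj'
        have h2 := hne y hy j hj'
        field_simp; ring
      rw [e, norm_div, norm_mul, norm_mul, div_mul_div_comm]
      have h1 := hsep j
      have h2 := hsep i
      refine div_le_div_of_nonneg_left (by positivity) (by positivity) ?_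
      calc sep x j * ((1 - s) * ((1 - s) * sep x i))
          = ((1 - s) * sep x j) * ((1 - s) * sep x i) := by ring
        _ ≤ ‖z - x j‖ * ‖y - x j‖ := mul_le_mul (hfar_j z hz j hj') (hfar_i y hy j hj')
          (by positivity) (norm_nonneg _)
    · rw [← Finset.sum_mul]
      have h2 := hsep i
      calc _ ≤ a * t * (‖y - z‖ / ((1 - s) * ((1 - s) * sep x i))) :=
            mul_le_mul_of_nonneg_right (hsum i) (by positivity)
        _ = _ := by ring
  -- `κ` collects `|Wᵢ| ≤ t dᵢ`, the Lipschitz constant `a t / ((1 - s) ^ 2 dᵢ)` of `S`, and two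
  -- factors `α`, with `s = t α`. It is below `1` because `s (1 + a) < 1 - s`. `C` bounds the factor
  -- in front of `z - φ z` on the disc.
  refine exists_isRoot_of_contraction hf0 (r := α * ‖W f x i‖)
    (κ := a * s ^ 2 / (1 - s) ^ 2)
    (C := ‖f.leadingCoeff‖ * (∏ j ∈ Finset.univ.erase i, (α * ‖W f x i‖ + ‖x i - x j‖)) *
      (1 + a * t / (1 - s)))
    (fun z => x i - W f x i / (1 + S z)) (by positivity) ?_ (by positivity) ?_ ?_ ?_ ?_
  · intro z hz
    rw [sub_sub_cancel_left, norm_neg, norm_div, div_eq_mul_inv, mul_comm]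
    exact mul_le_mul_of_nonneg_right (hSinv z hz) (norm_nonneg _)
  · rw [div_lt_one (by positivity)]
    have h1 : s * (1 + a) ≤ 1 - s := by linarith
    have h2 : (s * (1 + a)) ^ 2 ≤ (1 - s) ^ 2 := pow_le_pow_left₀ (by positivity) h1 2
    rcases hs0.eq_or_lt with h0 | h0
    · rw [← h0]; norm_num
    · nlinarith [mul_pos h0 h0]
  · intro y z hy hz
    have h1 := hSne y hy
    have h2 := hSne z hz
    have e : x i - W f x i / (1 + S y) - (x i - W f x i / (1 + S z))
        = W f x i * (S y - S z) * (1 + S y)⁻¹ * (1 + S z)⁻¹ := by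
      field_simp; ring
    rw [e, norm_mul, norm_mul, norm_mul, norm_inv, norm_inv, norm_sub_rev (S y)]
    have h3 := hsep i
    have h4 := (div_le_iff₀ (hsep i)).1 (hW i)
    calc ‖W f x i‖ * ‖S z - S y‖ * ‖1 + S y‖⁻¹ * ‖1 + S z‖⁻¹
        ≤ (t * sep x i) * (a * t / ((1 - s) * ((1 - s) * sep x i)) * ‖y - z‖) * α * α := by
          gcongr
          · exact hSlip y z hy hz
          · exact hSinv y hy
          · exact hSinv z hz
      _ = a * s ^ 2 / (1 - s) ^ 2 * ‖y - z‖ := by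
          rw [hsdef] at hs1 ⊢; field_simp
  · exact mul_nonneg (mul_nonneg (norm_nonneg _)
      (Finset.prod_nonneg fun j _ => by positivity)) (by positivity)
  · intro z hz
    rw [eval_eq_weierstrass_at hn hf hx i (hne z hz)]
    have h1 := hSne z hz
    have e : (z - x i) * (1 + ∑ j ∈ Finset.univ.erase i, W f x j / (z - x j)) + W f x i
        = (1 + S z) * (z - (x i - W f x i / (1 + S z))) := by
      have : ∑ j ∈ Finset.univ.erase i, W f x j / (z - x j) = S z := by rw [hS]
      rw [this]; field_simp; ring
    rw [e, norm_mul, norm_mul, norm_mul, norm_prod, ← mul_assoc]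
    gcongr with j hj
    · have h1 := norm_sub_le_norm_sub_add_norm_sub z (x i) (x j)
      linarith
    · have h1 := norm_add_le (1 : K) (S z)
      rw [norm_one] at h1
      linarith [hSnorm z hz]

/-- A vector with small `E_f` has a root-vector nearby. -/
theorem exists_rootVector_near [IsAlgClosed K] (hn : 2 ≤ n) (hf : f.natDegree = n)
    (hx : Function.Injective x) {p q : ℝ≥0∞} (hp : 1 ≤ p) (hpq : p⁻¹ + q⁻¹ = 1)
    (hE : E p f x ≤ radius n (aConst n q)) :
    ∃ ξ : Fin n → K, Function.Injective ξ ∧ (∀ i, f.IsRoot (ξ i)) ∧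
      ∀ i, ‖x i - ξ i‖ ≤ alpha (aConst n q) (E p f x) * ‖W f x i‖ := by
  have ha := one_le_aConst hn q
  have hsep := sep_pos hn hx
  have hE0 : 0 ≤ E p f x := pNorm_nonneg hp _
  obtain ⟨hα, hs0, hs, -, hαeq⟩ := alpha_spec hn ha hE0 hE
  have hW : ∀ i, ‖W f x i‖ / sep x i ≤ E p f x := fun i =>
    (le_abs_self _).trans (norm_le_pNorm hp (fun i => ‖W f x i‖ / sep x i) i)
  have hsum : ∀ i, ∑ j ∈ Finset.univ.erase i, ‖W f x j‖ / sep x j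
      ≤ aConst n q * E p f x := fun i =>
    sum_erase_le_aConst_mul_pNorm hn hp hpq (u := fun i => ‖W f x i‖ / sep x i)
      (fun i => div_nonneg (norm_nonneg _) (hsep i).le) i
  choose ξ hξ hroot using exists_isRoot_near hn hf hx ha hα hs0
    (hs.trans_lt (localRadius_lt hn ha)) hαeq hW hsum
  refine ⟨ξ, fun i j hij => ?_, hroot, fun i => by rw [norm_sub_rev]; exact hξ i⟩
  by_contra hne
  -- The discs of radius `τ dₖ` about the `xₖ` are disjoint since `2 τ < 1`, so the zeros found are
  -- distinct.
  have hb : ∀ k, ‖ξ k - x k‖ ≤ localRadius n (aConst n q) * sep x k := fun k => by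
    refine (hξ k).trans ?_
    have h1 := (div_le_iff₀ (hsep k)).1 (hW k)
    have h2 := mul_le_mul_of_nonneg_left h1 hα.le
    have h3 := mul_le_mul_of_nonneg_right hs (hsep k).le
    linarith
  have h1 := hb i
  have h2 := hb j
  rw [hij, norm_sub_rev] at h1
  have h3 := norm_sub_le_norm_sub_add_norm_sub (x i) (ξ j) (x j)
  have h4 := localRadius_lt_third hn ha
  have h5 := localRadius_pos hn ha
  have h6 := sep_le (x := x) (Ne.symm hne)
  have h7 := sep_le (x := x) hne
  rw [norm_sub_rev] at h7
  have h8 := hsep i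
  nlinarith

/-- Each `ηᵢ` is some `ξⱼ`. If `j ≠ i`, the discs about `xᵢ` and `xⱼ` would meet, which `τ < 1 / 3`
rules out. -/
theorem eq_of_near {ξ η : Fin n → K} (hlc : f.leadingCoeff ≠ 0)
    (hξ : ∀ z, f.eval z = f.leadingCoeff * ∏ i, (z - ξ i)) (hη : ∀ i, f.IsRoot (η i))
    (hx : Function.Injective x) {τ : ℝ} (hτ : τ < 1 / 3) (hτ0 : 0 ≤ τ)
    (h1 : ∀ i, ‖x i - ξ i‖ ≤ τ * sep x i) (h2 : ∀ i, ‖x i - η i‖ ≤ τ * sep x i) : η = ξ := by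
  funext i
  have h := (hη i).eq_zero
  rw [hξ, mul_eq_zero, or_iff_right hlc, Finset.prod_eq_zero_iff] at h
  obtain ⟨j, -, hj⟩ := h
  rw [sub_eq_zero] at hj
  rcases eq_or_ne j i with rfl | hne
  · exact hj
  exfalso
  have h3 := h1 j
  have h4 := h2 i
  rw [hj] at h4
  rw [norm_sub_rev] at h3
  have h5 := norm_sub_le_norm_sub_add_norm_sub (x i) (ξ j) (x j)
  have h6 := sep_le (x := x) hne
  have h7 := sep_le (x := x) hne.symm
  rw [norm_sub_rev] at h7
  have h8 : 0 < ‖x i - x j‖ := norm_pos_iff.2 (sub_ne_zero.2 fun h => hne (hx h).symm)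
  nlinarith

end Semilocal

end SimRoots

namespace SimRoots

/-! ### Error propagation under `T^{(N)}` near a root-vector -/

section Local

variable {K : Type*} [NormedField K] {n : ℕ} {f : Polynomial K} {x ξ : Fin n → K} {p q : ℝ≥0∞}

/-- The relative error `‖(x - ξ) / d(x)‖_p`. -/
noncomputable def relError (p : ℝ≥0∞) (ξ x : Fin n → K) : ℝ :=
  pNorm p (fun i => ‖x i - ξ i‖ / sep x i)

theorem norm_sub_le_relError_mul_sep (hn : 2 ≤ n) (hp : 1 ≤ p) (hx : Function.Injective x)
    (i : Fin n) : ‖x i - ξ i‖ ≤ relError p ξ x * sep x i :=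
  (div_le_iff₀ (sep_pos hn hx i)).1
    ((le_abs_self _).trans (norm_le_pNorm hp (fun i => ‖x i - ξ i‖ / sep x i) i))

/-- Writing `f` in factored form, the new error is `-(∏_{j ≠ i} (1 + (yⱼ - ξⱼ) / (xᵢ - yⱼ)) - 1) (xᵢ
- ξᵢ)`. AM-GM bounds the product through the sum of the relative errors of `y`, and convexity
extracts `L * lam`. -/
theorem norm_ehrlich_step_le {a lam L : ℝ} (hn : 2 ≤ n) (ha : 1 ≤ a) (hlc : f.leadingCoeff ≠ 0)
    (hξ : ∀ z, f.eval z = f.leadingCoeff * ∏ i, (z - ξ i))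
    (hlam0 : 0 ≤ lam) (hlam1 : lam ≤ 1) (hL0 : 0 ≤ L) (hL1 : L ≤ 1)
    {u : Fin n → ℝ} {y : Fin n → K}
    (hsum : ∀ i, ∑ j ∈ Finset.univ.erase i, u j ≤ lam * (a * localRadius n a))
    (hsharp : Sharp x y) (hy : ∀ i j, i ≠ j → ‖y j - ξ j‖ ≤ L * u j * ‖x i - y j‖) (i : Fin n) :
    ‖x i - f.eval (x i) / (f.leadingCoeff * ∏ j ∈ Finset.univ.erase i, (x i - y j)) - ξ i‖
      ≤ errorFactor n a * (L * lam) * ‖x i - ξ i‖ := by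
  have hne : ∀ j ∈ Finset.univ.erase i, x i - y j ≠ 0 := fun j hj =>
    sub_ne_zero.2 (hsharp i j (Finset.ne_of_mem_erase hj).symm)
  have hprod : ∏ j ∈ Finset.univ.erase i, (x i - y j) ≠ 0 := Finset.prod_ne_zero_iff.2 hne
  have hratio : (∏ j ∈ Finset.univ.erase i, (x i - ξ j)) / ∏ j ∈ Finset.univ.erase i, (x i - y j)
      = ∏ j ∈ Finset.univ.erase i, (1 + (y j - ξ j) / (x i - y j)) := by
    rw [← Finset.prod_div_distrib]
    refine Finset.prod_congr rfl fun j hj => ?_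
    have := hne j hj
    field_simp; ring
  have e : x i - f.eval (x i) / (f.leadingCoeff * ∏ j ∈ Finset.univ.erase i, (x i - y j)) - ξ i
      = -((∏ j ∈ Finset.univ.erase i, (1 + (y j - ξ j) / (x i - y j)) - 1) * (x i - ξ i)) := by
    rw [← hratio, hξ, ← Finset.mul_prod_erase _ _ (Finset.mem_univ i)]
    field_simp; ring
  rw [e, norm_neg, norm_mul]
  refine mul_le_mul_of_nonneg_right ?_ (norm_nonneg _)
  refine (norm_prod_one_add_sub_one_le _ _).trans ?_
  have hcard : (Finset.univ.erase i).card = n - 1 := by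
    rw [Finset.card_erase_of_mem (Finset.mem_univ _), Finset.card_univ, Fintype.card_fin]
  have hm : (0 : ℝ) < (n - 1 : ℕ) := by exact_mod_cast (by omega : 0 < n - 1)
  have h1 := prod_one_add_le_pow (Finset.univ.erase i) (fun j => ‖(y j - ξ j) / (x i - y j)‖)
    fun _ _ => norm_nonneg _
  rw [hcard] at h1
  have h2 : ∑ j ∈ Finset.univ.erase i, ‖(y j - ξ j) / (x i - y j)‖
      ≤ L * lam * (a * localRadius n a) := by
    calc _ ≤ ∑ j ∈ Finset.univ.erase i, L * u j := Finset.sum_le_sum fun j hj => by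
          rw [norm_div, div_le_iff₀ (norm_pos_iff.2 (hne j hj))]
          exact hy i j (Finset.ne_of_mem_erase hj).symm
      _ = L * ∑ j ∈ Finset.univ.erase i, u j := by rw [Finset.mul_sum]
      _ ≤ L * (lam * (a * localRadius n a)) := mul_le_mul_of_nonneg_left (hsum i) hL0
      _ = _ := by ring
  have h3 := localRadius_pos hn ha
  have h4 := one_add_mul_pow_sub_one_le (y := a * localRadius n a / (n - 1 : ℕ)) (θ := L * lam)
    (by positivity) (by positivity) (mul_le_one₀ hL1 hlam0 hlam1) (n - 1)
  have h5 : (1 + (∑ j ∈ Finset.univ.erase i, ‖(y j - ξ j) / (x i - y j)‖) / (n - 1 : ℕ)) ^ (n - 1)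
      ≤ (1 + L * lam * (a * localRadius n a / (n - 1 : ℕ))) ^ (n - 1) := by
    rw [← mul_div_assoc]
    have : 0 ≤ ∑ j ∈ Finset.univ.erase i, ‖(y j - ξ j) / (x i - y j)‖ :=
      Finset.sum_nonneg fun _ _ => norm_nonneg _
    gcongr
  rw [errorFactor]
  linarith

theorem sub_errorFactor_le {a : ℝ} (hn : 2 ≤ n) (ha : 1 ≤ a) {u : Fin n → ℝ} {y : Fin n → K}
    (hu : ∀ i, u i ≤ localRadius n a) (hx : ∀ i, ‖x i - ξ i‖ = u i * sep x i)
    (hy : ∀ i, ‖y i - ξ i‖ ≤ errorFactor n a * ‖x i - ξ i‖) (i : Fin n) {r : ℝ}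
    (hr : sep x i ≤ r) :
    ‖x i - y i‖ ≤ (1 + errorFactor n a) * localRadius n a * r := by
  have hB := errorFactor_pos hn ha
  have hs := sep_nonneg hn x i
  have h1 := norm_sub_le_norm_sub_add_norm_sub (x i) (ξ i) (y i)
  rw [norm_sub_rev (ξ i)] at h1
  have h2 : ‖x i - ξ i‖ ≤ localRadius n a * r := by
    rw [hx]
    exact mul_le_mul (hu i) hr hs (localRadius_pos hn ha).le
  have h3 := mul_le_mul_of_nonneg_left h2 (by linarith : 0 ≤ 1 + errorFactor n a)
  linarith [hy i]

/-- Induction on `N`, carrying the error of `T^{(N)}` relative to `|xᵢ - Tⱼ|`, which is the input of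
the next correction. The last bound needs `1 ≤ N`, as its factor `errorFactor` comes from a
correction actually performed. -/
theorem norm_T_sub_le (hn : 2 ≤ n) (hp : 1 ≤ p) (hpq : p⁻¹ + q⁻¹ = 1)
    (hlc : f.leadingCoeff ≠ 0) (hξ : ∀ z, f.eval z = f.leadingCoeff * ∏ i, (z - ξ i))
    (hx : Function.Injective x) {lam : ℝ} (hlam0 : 0 ≤ lam) (hlam1 : lam ≤ 1)
    (hE : relError p ξ x ≤ lam * localRadius n (aConst n q)) (N : ℕ) :
    x ∈ dom f N ∧ Sharp x (T f N x) ∧ (∀ i j, i ≠ j →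
        ‖T f N x j - ξ j‖ ≤ lam ^ N * (‖x j - ξ j‖ / sep x j) * ‖x i - T f N x j‖) ∧
      (1 ≤ N → ∀ i, ‖T f N x i - ξ i‖ ≤ errorFactor n (aConst n q) * lam ^ N * ‖x i - ξ i‖) := by
  have ha := one_le_aConst hn q
  have hsep := sep_pos hn hx
  have hτ := localRadius_pos hn ha
  have hB := errorFactor_pos hn ha
  have hB' := errorFactor_le hn ha
  have hu : ∀ i, ‖x i - ξ i‖ / sep x i ≤ lam * localRadius n (aConst n q) := fun i =>
    ((le_abs_self _).trans (norm_le_pNorm hp (fun i => ‖x i - ξ i‖ / sep x i) i)).trans hE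
  have hsum : ∀ i, ∑ j ∈ Finset.univ.erase i, ‖x j - ξ j‖ / sep x j
      ≤ lam * (aConst n q * localRadius n (aConst n q)) := fun i => by
    have h := sum_erase_le_aConst_mul_pNorm hn hp hpq (u := fun i => ‖x i - ξ i‖ / sep x i)
      (fun i => div_nonneg (norm_nonneg _) (hsep i).le) i
    have h2 := mul_le_mul_of_nonneg_left hE (by linarith : 0 ≤ aConst n q)
    unfold relError at h2
    linarith
  induction N with
  | zero =>
    refine ⟨trivial, fun i j hij h => hij (hx h), fun i j hij => ?_, fun h => by omega⟩
    simp only [T, pow_zero, one_mul]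
    rw [div_mul_eq_mul_div, le_div_iff₀ (hsep j)]
    refine mul_le_mul_of_nonneg_left ?_ (norm_nonneg _)
    rw [norm_sub_rev]
    exact sep_le hij
  | succ N ih =>
    obtain ⟨hdom, hsharp, hrel, -⟩ := ih
    have hstep := norm_ehrlich_step_le hn ha hlc hξ hlam0 hlam1 (pow_nonneg hlam0 N)
      (pow_le_one₀ hlam0 hlam1) hsum hsharp hrel
    have hT : ∀ i, ‖T f (N + 1) x i - ξ i‖
        ≤ errorFactor n (aConst n q) * lam ^ (N + 1) * ‖x i - ξ i‖ := fun i => by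
      rw [pow_succ]; exact hstep i
    have hT1 : ∀ i, ‖T f (N + 1) x i - ξ i‖ ≤ errorFactor n (aConst n q) * ‖x i - ξ i‖ :=
      fun i => (hT i).trans (mul_le_mul_of_nonneg_right
        (mul_le_of_le_one_right hB.le (pow_le_one₀ hlam0 hlam1)) (norm_nonneg _))
    -- Only `Tⱼ` has moved away from `xⱼ`, so half of the slack in `errorFactor_le` suffices.
    have hfar : ∀ i j, i ≠ j → errorFactor n (aConst n q) * sep x j ≤ ‖x i - T f (N + 1) x j‖ := by
      intro i j hij
      have h1 := sub_errorFactor_le hn ha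
        (fun i => (hu i).trans (mul_le_of_le_one_left hτ.le hlam1))
        (fun i => (div_mul_cancel₀ _ (hsep i).ne').symm) hT1 j (sep_le hij)
      have h2 := norm_sub_le_norm_sub_add_norm_sub (x j) (T f (N + 1) x j) (x i)
      rw [norm_sub_rev (T f (N + 1) x j)] at h2
      have h3 := sep_le (x := x) hij
      have h4 := mul_le_mul_of_nonneg_right hB' (norm_nonneg (x j - x i))
      have h5 := mul_le_mul_of_nonneg_left h3 hB.le
      have h6 : 0 ≤ (1 + errorFactor n (aConst n q)) * localRadius n (aConst n q) *
        ‖x j - x i‖ := by positivity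
      linarith
    refine ⟨⟨hdom, hsharp⟩, fun i j hij => ?_, fun i j hij => ?_, fun _ => hT⟩
    · exact sub_ne_zero.1 (norm_pos_iff.1 ((mul_pos hB (hsep j)).trans_le (hfar i j hij)))
    · have h1 := hfar i j hij
      have h2 := hsep j
      calc ‖T f (N + 1) x j - ξ j‖
          ≤ errorFactor n (aConst n q) * lam ^ (N + 1) * ‖x j - ξ j‖ := hT j
        _ = lam ^ (N + 1) * (‖x j - ξ j‖ / sep x j) * (errorFactor n (aConst n q) * sep x j) := by
            field_simp
        _ ≤ _ := by gcongr

theorem injective_T_and_relError_le (hn : 2 ≤ n) (hp : 1 ≤ p) (hpq : p⁻¹ + q⁻¹ = 1)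
    (hlc : f.leadingCoeff ≠ 0) (hξ : ∀ z, f.eval z = f.leadingCoeff * ∏ i, (z - ξ i))
    (hx : Function.Injective x) {lam : ℝ} (hlam0 : 0 ≤ lam) (hlam1 : lam ≤ 1)
    (hE : relError p ξ x ≤ lam * localRadius n (aConst n q)) {N : ℕ} (hN : 1 ≤ N) :
    Function.Injective (T f N x) ∧ relError p ξ (T f N x) ≤ lam ^ N * relError p ξ x := by
  have ha := one_le_aConst hn q
  have hsep := sep_pos hn hx
  have hτ := localRadius_pos hn ha
  have hB := errorFactor_pos hn ha
  have hB' := errorFactor_le hn ha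
  have hu : ∀ i, ‖x i - ξ i‖ / sep x i ≤ localRadius n (aConst n q) := fun i =>
    (((le_abs_self _).trans (norm_le_pNorm hp (fun i => ‖x i - ξ i‖ / sep x i) i)).trans hE).trans
      (mul_le_of_le_one_left hτ.le hlam1)
  have hT := (norm_T_sub_le hn hp hpq hlc hξ hx hlam0 hlam1 hE N).2.2.2 hN
  have hT1 : ∀ i, ‖T f N x i - ξ i‖ ≤ errorFactor n (aConst n q) * ‖x i - ξ i‖ :=
    fun i => (hT i).trans (mul_le_mul_of_nonneg_right
      (mul_le_of_le_one_right hB.le (pow_le_one₀ hlam0 hlam1)) (norm_nonneg _))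
  have hmove := sub_errorFactor_le hn ha hu (fun i => (div_mul_cancel₀ _ (hsep i).ne').symm) hT1
  -- Both components have moved here, which uses the full `2 (1 + B) τ` of `errorFactor_le`.
  have hdist : ∀ i j, j ≠ i →
      errorFactor n (aConst n q) * sep x i ≤ ‖T f N x i - T f N x j‖ := by
    intro i j hij
    have h1 := hmove i (sep_le hij)
    have h2 := hmove j (sep_le hij.symm)
    rw [norm_sub_rev (x j) (x i)] at h2
    have h3 := norm_sub_le_norm_sub_add_norm_sub (x i) (T f N x i) (x j)
    have h4 := norm_sub_le_norm_sub_add_norm_sub (T f N x i) (T f N x j) (x j)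
    rw [norm_sub_rev (T f N x j) (x j)] at h4
    have h5 := mul_le_mul_of_nonneg_right hB' (norm_nonneg (x i - x j))
    have h6 := mul_le_mul_of_nonneg_left (sep_le (x := x) hij) hB.le
    linarith
  refine ⟨fun i j hij => ?_, ?_⟩
  · by_contra hne
    have h1 := hdist i j (Ne.symm hne)
    rw [hij, sub_self, norm_zero] at h1
    have := mul_pos hB (hsep i)
    linarith
  · refine pNorm_le_mul hp (pow_nonneg hlam0 N) fun i => ?_
    have h1 := hsep i
    have h2 : errorFactor n (aConst n q) * sep x i ≤ sep (T f N x) i := le_sep hn (hdist i)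
    have h3 : 0 < errorFactor n (aConst n q) * sep x i := mul_pos hB h1
    rw [Real.norm_of_nonneg (by have := h3.trans_le h2; positivity),
      Real.norm_of_nonneg (by positivity)]
    calc ‖T f N x i - ξ i‖ / sep (T f N x) i
        ≤ (errorFactor n (aConst n q) * lam ^ N * ‖x i - ξ i‖) /
            (errorFactor n (aConst n q) * sep x i) :=
          div_le_div₀ (by positivity) (hT i) h3 h2
      _ = _ := by field_simp

/-- A relative error of at most `1 / 2` forces `|ξᵢ - ξⱼ| ≤ 2 |xᵢ - xⱼ|`, so the separation of `x`
is at least `δ / 2`. This passes from the relative error back to the absolute one. -/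
theorem relError_le_of_sep (hn : 2 ≤ n) (hp : 1 ≤ p) (hx : Function.Injective x)
    (hE : relError p ξ x ≤ 1 / 2) {δ : ℝ} (hδ : 0 < δ) (h : ∀ i, δ ≤ sep ξ i) :
    relError p ξ x ≤ 2 / δ * pNorm p (x - ξ) := by
  refine pNorm_le_mul hp (by positivity) fun i => ?_
  have hsep := sep_pos hn hx
  rw [Real.norm_of_nonneg (by have := hsep i; positivity), Pi.sub_apply]
  have h1 : δ / 2 ≤ sep x i := le_sep hn fun j hj => by
    have hb : ∀ k, ‖x k - ξ k‖ ≤ 1 / 2 * sep x k := fun k =>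
      (norm_sub_le_relError_mul_sep hn hp hx k).trans
        (mul_le_mul_of_nonneg_right hE (hsep k).le)
    have h2 := hb i
    have h3 := hb j
    have h4 := sep_le (x := x) hj
    have h5 := sep_le (x := x) hj.symm
    have h6 := sep_le (x := ξ) hj
    have h7 := norm_sub_le_norm_sub_add_norm_sub (ξ i) (x i) (ξ j)
    have h8 := norm_sub_le_norm_sub_add_norm_sub (x i) (x j) (ξ j)
    rw [norm_sub_rev (ξ i) (x i)] at h7
    rw [norm_sub_rev (x j)] at h5
    linarith [h i]
  calc ‖x i - ξ i‖ / sep x i ≤ ‖x i - ξ i‖ / (δ / 2) :=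
        div_le_div_of_nonneg_left (norm_nonneg _) (by positivity) h1
    _ = _ := by field_simp

end Local

end SimRoots

/-! ### The main theorem -/

theorem mainTheorem5 {K : Type*} [NormedField K] [IsAlgClosed K]
    (n : ℕ) (hn : 2 ≤ n) (f : Polynomial K) (hf : f.natDegree = n)
    (N : ℕ) (hN : 1 ≤ N)
    (p q : ℝ≥0∞) (hp : 1 ≤ p) (hpq : p⁻¹ + q⁻¹ = 1)
    (x₀ : Fin n → K) (hx₀ : Function.Injective x₀)
    (hE : SimRoots.E p f x₀ < SimRoots.radius n (SimRoots.aConst n q)) :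
    SimRoots.OnlySimpleZeros f ∧
    (∀ k : ℕ, SimRoots.iter f N x₀ k ∈ SimRoots.dom f N ∧
      Function.Injective (SimRoots.iter f N x₀ k)) ∧
    ∃ ξ : Fin n → K, SimRoots.IsRootVector f ξ ∧
      SimRoots.ConvergesWithOrder p (N + 1) (SimRoots.iter f N x₀) ξ ∧
      ∀ k : ℕ,
        SimRoots.E p f (SimRoots.iter f N x₀ k) ≤ SimRoots.radius n (SimRoots.aConst n q) →
        SimRoots.coneNorm (SimRoots.iter f N x₀ k - ξ) ≤
          SimRoots.alpha (SimRoots.aConst n q) (SimRoots.E p f (SimRoots.iter f N x₀ k)) •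
            SimRoots.coneNorm (SimRoots.W f (SimRoots.iter f N x₀ k)) := by
  open SimRoots in
  have hf0 : f ≠ 0 := by rintro rfl; simp at hf; omega
  have hlc : f.leadingCoeff ≠ 0 := Polynomial.leadingCoeff_ne_zero.2 hf0
  have ha := one_le_aConst hn q
  have hτ := localRadius_pos hn ha
  have hτ3 := localRadius_lt_third hn ha
  have hB := errorFactor_pos hn ha
  have hB' := errorFactor_le hn ha
  obtain ⟨ξ, hξinj, hξroot, hξnear⟩ := exists_rootVector_near hn hf hx₀ hp hpq hE.le
  have hξ := eval_eq_of_isRoot hn hf hξinj hξroot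
  have hrel : ∀ x η : Fin n → K, Function.Injective x →
      E p f x ≤ radius n (aConst n q) →
      (∀ i, ‖x i - η i‖ ≤ alpha (aConst n q) (E p f x) * ‖W f x i‖) →
      relError p η x ≤ E p f x * alpha (aConst n q) (E p f x) := by
    intro x η hx hEx hη
    have hα := (alpha_spec hn ha (pNorm_nonneg hp _ : 0 ≤ E p f x) hEx).1
    rw [mul_comm]
    refine pNorm_le_mul hp hα.le fun i => ?_
    have := sep_pos hn hx i
    rw [Real.norm_of_nonneg (by positivity), Real.norm_of_nonneg (by positivity), ← mul_div_assoc]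
    exact div_le_div_of_nonneg_right (hη i) this.le
  -- The witness is `lam = s / τ` with `s = E * alpha a E` at `x₀`; the strict bound on `E` makes it
  -- less than `1`.
  obtain ⟨lam, hlam0, hlam1, hlam⟩ : ∃ lam : ℝ, 0 ≤ lam ∧ lam < 1 ∧
      relError p ξ x₀ ≤ lam * localRadius n (aConst n q) := by
    obtain ⟨-, hs0, -, hs, -⟩ := alpha_spec hn ha (pNorm_nonneg hp _ : 0 ≤ E p f x₀) hE.le
    refine ⟨_, div_nonneg hs0 hτ.le, (div_lt_one hτ).2 (hs hE), ?_⟩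
    rw [div_mul_cancel₀ _ hτ.ne']
    exact hrel x₀ ξ hx₀ hE.le hξnear
  have hiter : ∀ k, iter f N x₀ (k + 1) = T f N (iter f N x₀ k) := fun k =>
    Function.iterate_succ_apply' _ _ _
  have hinv : ∀ k, Function.Injective (iter f N x₀ k) ∧
      relError p ξ (iter f N x₀ k) ≤ lam * localRadius n (aConst n q) := by
    intro k
    induction k with
    | zero => exact ⟨hx₀, hlam⟩
    | succ k ih =>
      rw [hiter]
      have h := injective_T_and_relError_le hn hp hpq hlc hξ ih.1 hlam0 hlam1.le ih.2 hN
      refine ⟨h.1, h.2.trans (le_trans ?_ ih.2)⟩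
      exact mul_le_of_le_one_left (pNorm_nonneg hp _) (pow_le_one₀ hlam0 hlam1.le)
  have hle : ∀ k, relError p ξ (iter f N x₀ k) ≤ localRadius n (aConst n q) := fun k =>
    (hinv k).2.trans (mul_le_of_le_one_left hτ.le hlam1.le)
  have hB1 : errorFactor n (aConst n q) ≤ 1 := by
    have : 0 ≤ (1 + errorFactor n (aConst n q)) * localRadius n (aConst n q) := by positivity
    linarith
  refine ⟨onlySimpleZeros_of_isRoot hn hf hξinj hξroot, fun k => ⟨?_, (hinv k).1⟩, ξ,
    ⟨f.leadingCoeff, hξ⟩, ⟨?_, ?_⟩, ?_⟩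
  · exact (norm_T_sub_le hn hp hpq hlc hξ (hinv k).1 hlam0 hlam1.le (hinv k).2 N).1
  · rw [tendsto_pi_nhds]
    intro i
    have hbound : ∀ k, ‖iter f N x₀ k i - ξ i‖ ≤ lam ^ k * ‖x₀ i - ξ i‖ := by
      intro k
      induction k with
      | zero => simp [iter]
      | succ k ih =>
        rw [hiter]
        have h := (norm_T_sub_le hn hp hpq hlc hξ (hinv k).1 hlam0 hlam1.le (hinv k).2 N).2.2.2
          hN i
        refine h.trans ?_
        rw [pow_succ', mul_assoc lam]
        refine mul_le_mul ?_ ih (norm_nonneg _) hlam0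
        calc errorFactor n (aConst n q) * lam ^ N ≤ 1 * lam :=
              mul_le_mul hB1 (pow_le_of_le_one hlam0 hlam1.le (by omega)) (by positivity)
                zero_le_one
          _ = lam := one_mul _
    rw [tendsto_iff_norm_sub_tendsto_zero]
    refine squeeze_zero (fun _ => norm_nonneg _) hbound ?_
    simpa using (tendsto_pow_atTop_nhds_zero_of_lt_one hlam0 hlam1).mul_const ‖x₀ i - ξ i‖
  · have : Nonempty (Fin n) := ⟨⟨0, by omega⟩⟩
    obtain ⟨i₀, hi₀⟩ := Finite.exists_min (sep ξ)
    have hδ := sep_pos hn hξinj i₀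
    refine ⟨errorFactor n (aConst n q) * (2 / sep ξ i₀ / localRadius n (aConst n q)) ^ N,
      fun k => ?_⟩
    have hx := (hinv k).1
    have hR0 : 0 ≤ relError p ξ (iter f N x₀ k) := pNorm_nonneg hp _
    -- Here `lam` is the relative error of the current iterate divided by `τ`, not the fixed
    -- contraction factor. Its `N`-th power supplies the `N` extra powers of the error.
    have h1 := (norm_T_sub_le hn hp hpq hlc hξ hx (div_nonneg hR0 hτ.le)
      ((div_le_one hτ).2 (hle k)) (div_mul_cancel₀ _ hτ.ne').ge N).2.2.2 hN
    have h2 := relError_le_of_sep hn hp hx ((hle k).trans (by linarith)) hδ hi₀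
    have h3 : relError p ξ (iter f N x₀ k) / localRadius n (aConst n q)
        ≤ 2 / sep ξ i₀ / localRadius n (aConst n q) * pNorm p (iter f N x₀ k - ξ) := by
      rw [div_mul_eq_mul_div]
      exact div_le_div_of_nonneg_right h2 hτ.le
    rw [hiter]
    calc pNorm p (T f N (iter f N x₀ k) - ξ)
        ≤ errorFactor n (aConst n q) *
            (relError p ξ (iter f N x₀ k) / localRadius n (aConst n q)) ^ N *
            pNorm p (iter f N x₀ k - ξ) :=
          pNorm_le_mul hp (by positivity) h1
      _ ≤ errorFactor n (aConst n q) *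
            (2 / sep ξ i₀ / localRadius n (aConst n q) * pNorm p (iter f N x₀ k - ξ)) ^ N *
            pNorm p (iter f N x₀ k - ξ) := by
          have := pNorm_nonneg hp (iter f N x₀ k - ξ)
          gcongr
      _ = _ := by rw [mul_pow]; ring
  · intro k hk i
    -- The semilocal result at the `k`-th iterate gives some root-vector `η`; it equals `ξ` because
    -- both lie within relative distance `τ < 1 / 3` of that iterate.
    obtain ⟨η, -, hηroot, hηnear⟩ := exists_rootVector_near hn hf (hinv k).1 hp hpq hk
    have hs := (alpha_spec hn ha (pNorm_nonneg hp _ : 0 ≤ E p f (iter f N x₀ k)) hk).2.2.1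
    have hsep := fun i => (sep_pos hn (hinv k).1 i).le
    have : η = ξ := eq_of_near hlc hξ hηroot (hinv k).1 hτ3 hτ.le
      (fun i => (norm_sub_le_relError_mul_sep hn hp (hinv k).1 i).trans
        (mul_le_mul_of_nonneg_right (hle k) (hsep i)))
      (fun i => (norm_sub_le_relError_mul_sep hn hp (hinv k).1 i).trans
        (mul_le_mul_of_nonneg_right ((hrel _ η (hinv k).1 hk hηnear).trans hs) (hsep i)))
    rw [← this]
    exact hηnear i
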